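/- Let $M,N$ be positive integers. For matrix-valued functions on $\mathbb{R}$, let $U^*$ denote the pointwise conjugate transpose, let $L^2(\mathbb{R};\mathbb{C}^{M\times N})$ carry the inner product $\langle U,V\rangle=\int_{\mathbb{R}}\mathrm{tr}(U(x)V(x)^*)\,dx$, and let $\Pi_{\ge 0}$ be the Szegő projector, i.e. the Fourier multiplier $\widehat{\Pi_{\ge 0}U}(\xi)=\mathbf{1}_{\xi\ge 0}\,\hat U(\xi)$ on $L^2(\mathbb{R};\mathbb{C}^{M\times N})$. Put $L^2_+=\Pi_{\ge 0}(L^2)$ and $H^s_+=\Pi_{\ge 0}(H^s)$, where $H^s$ is the $L^2$-based Sobolev space with its usual norm. Let $s>\frac12$ and let $U\in C^\infty(\mathbb{R};H^s_+(\mathbb{R};\mathbb{C}^{M\times N}))$ be a solution of the cubic matrix Szegő equation $$ i\,\partial_t U=\Pi_{\ge 0}(UU^*U),\qquad (t,x)\in\mathbb{R}\times\mathbb{R}. $$ For a positive integer $d$ and $t\in\mathbb{R}$, consider the bounded antilinear Hankel operators $$ \mathbf{H}^{(\mathbf r)}_{U(t)}:F\in L^2_+(\mathbb{R};\mathbb{C}^{d\times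 N})\mapsto \Pi_{\ge 0}(U(t)F^*)\in L^2_+(\mathbb{R};\mathbb{C}^{M\times d}),\qquad \mathbf{H}^{(\mathbf l)}_{U(t)}:G\in L^2_+(\mathbb{R};\mathbb{C}^{M\times d})\mapsto \Pi_{\ge 0}(G^*U(t))\in L^2_+(\mathbb{R};\mathbb{C}^{d\times N}), $$ and the bounded linear Toeplitz operators $\mathbf{T}^{(\mathbf r)}_{U(t)U(t)^*}(G)=\Pi_{\ge 0}(U(t)U(t)^*G)$ on $L^2_+(\mathbb{R};\mathbb{C}^{M\times d})$ and $\mathbf{T}^{(\mathbf l)}_{U(t)^*U(t)}(F)=\Pi_{\ge 0}(FU(t)^*U(t))$ on $L^2_+(\mathbb{R};\mathbb{C}^{d\times N})$. Then, for every positive integer $d$, the time-dependent operators satisfy $$ \mathbf{H}^{(\mathbf r)}_{U}\mathbf{H}^{(\mathbf l)}_{U}\in C^\infty(\mathbb{R};\mathcal{B}(L^2_+(\mathbb{R};\mathbb{C}^{M\times d}))),\qquad \mathbf{H}^{(\mathbf l)}_{U}\mathbf{H}^{(\mathbf r)}_{U}\in C^\infty(\mathbb{R};\mathcal{B}(L^2_+(\mathbb{R};\mathbb{C}^{d\times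 N}))), $$ where $\mathcal{B}$ denotes the space of bounded $\mathbb{C}$-linear operators with the operator norm, and, for all $t\in\mathbb{R}$, with $[A,B]=AB-BA$, $$ \tfrac{d}{dt}\big(\mathbf{H}^{(\mathbf r)}_{U(t)}\mathbf{H}^{(\mathbf l)}_{U(t)}\big)=i\big[\mathbf{H}^{(\mathbf r)}_{U(t)}\mathbf{H}^{(\mathbf l)}_{U(t)},\,\mathbf{T}^{(\mathbf r)}_{U(t)U(t)^*}\big],\qquad \tfrac{d}{dt}\big(\mathbf{H}^{(\mathbf l)}_{U(t)}\mathbf{H}^{(\mathbf r)}_{U(t)}\big)=i\big[\mathbf{H}^{(\mathbf l)}_{U(t)}\mathbf{H}^{(\mathbf r)}_{U(t)},\,\mathbf{T}^{(\mathbf l)}_{U(t)^*U(t)}\big]. $$ -/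

import Mathlib

open MeasureTheory Complex
open scoped ENNReal FourierTransform ContDiff Matrix ComplexConjugate

noncomputable section

namespace MatrixSzego

/-! ### Complex matrices with the Hilbert-Schmidt (Frobenius) inner product -/

/-- The space `ℂ^{M × N}`, with the inner product `tr (A * Bᴴ) = ∑ A i j * conj (B i j)`. -/
abbrev CMat (M N : ℕ) : Type := EuclideanSpace ℂ (Fin M × Fin N)

/-- An element of `CMat M N`, read as a matrix. -/
def CMat.toMatrix {M N : ℕ} (A : CMat M N) : Matrix (Fin M) (Fin N) ℂ :=
  Matrix.of fun i j => A (i, j)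

/-- A matrix, read as an element of `CMat M N`. -/
def CMat.ofMatrix {M N : ℕ} (A : Matrix (Fin M) (Fin N) ℂ) : CMat M N :=
  WithLp.toLp 2 fun p => A p.1 p.2

/-- Matrix multiplication `(A, B) ↦ A * B`, as a continuous bilinear map. -/
def CMat.mulL (M N P : ℕ) : CMat M N →L[ℂ] CMat N P →L[ℂ] CMat M P :=
  (LinearMap.mk₂ ℂ (fun A B => CMat.ofMatrix (A.toMatrix * B.toMatrix))
    (by intros; ext; simp [CMat.ofMatrix, CMat.toMatrix, Matrix.mul_apply, add_mul,
      Finset.sum_add_distrib])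
    (by intros; ext; simp [CMat.ofMatrix, CMat.toMatrix, Matrix.mul_apply, mul_assoc,
      Finset.mul_sum])
    (by intros; ext; simp [CMat.ofMatrix, CMat.toMatrix, Matrix.mul_apply, mul_add,
      Finset.sum_add_distrib])
    (by intros; ext; simp [CMat.ofMatrix, CMat.toMatrix, Matrix.mul_apply, mul_left_comm,
      Finset.mul_sum])).toContinuousBilinearMap

/-- The adjoint (conjugate transpose) `A ↦ Aᴴ`, as a continuous antilinear map. -/
def CMat.adjL (M N : ℕ) : CMat M N →L⋆[ℂ] CMat N M where
  toFun A := CMat.ofMatrix A.toMatrixᴴ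
  map_add' _ _ := by ext; simp [CMat.ofMatrix, CMat.toMatrix]
  map_smul' _ _ := by ext; simp [CMat.ofMatrix, CMat.toMatrix]
  cont := by
    simp only [CMat.ofMatrix, CMat.toMatrix, Matrix.conjTranspose_apply, Matrix.of_apply]
    fun_prop

/-! ### Matrix-valued Lebesgue spaces on the line -/

/-- `L^p(ℝ; ℂ^{M × N})`. -/
abbrev LpMat (p : ℝ≥0∞) (M N : ℕ) : Type := Lp (CMat M N) p (volume : Measure ℝ)

/-- `L²(ℝ; ℂ^{M × N})`, a complex Hilbert space with inner product `∫ tr (U Vᴴ)`. -/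
abbrev L2 (M N : ℕ) : Type := LpMat 2 M N

/-- `L^∞(ℝ; ℂ^{M × N})`. -/
abbrev Linf (M N : ℕ) : Type := LpMat ∞ M N

/-- The pointwise matrix product `x ↦ f x * g x` of `f ∈ L^p` and `g ∈ L^q`, as an element
of `L^r` with `1/r = 1/p + 1/q`. -/
def mulLp {p q r : ℝ≥0∞} [ENNReal.HolderTriple p q r]
    [Fact (1 ≤ p)] [Fact (1 ≤ q)] [Fact (1 ≤ r)] {M N P : ℕ} :
    LpMat p M N →L[ℂ] LpMat q N P →L[ℂ] LpMat r M P :=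
  (CMat.mulL M N P).holderL volume p q r

/-- The pointwise adjoint `x ↦ (f x)ᴴ` of a matrix-valued function. -/
def adjLp (p : ℝ≥0∞) [Fact (1 ≤ p)] (M N : ℕ) : LpMat p M N →L⋆[ℂ] LpMat p N M :=
  (CMat.adjL M N).compLpL p volume

/-! ### The Szegő projector -/

/-- The Heaviside symbol `1_{[0, ∞)}`. -/
def heaviside : Lp ℂ ∞ (volume : Measure ℝ) :=
  ((memLp_top_const (1 : ℂ)).indicator (measurableSet_Ici (a := (0 : ℝ)))).toLp

/-- The Fourier transform on `L²(ℝ; ℂ^{M × N})`, normalised with the kernel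
`exp (-2 π i x ξ)`, so that it is unitary. -/
def fourierL2 (M N : ℕ) : L2 M N ≃ₗᵢ[ℂ] L2 M N :=
  Lp.fourierTransformₗᵢ ℝ (CMat M N)

/-- The Szegő projector `Π_{≥ 0}` on `L²(ℝ; ℂ^{M × N})`, the Fourier multiplier with symbol
`1_{[0, ∞)}`. -/
def szego (M N : ℕ) : L2 M N →L[ℂ] L2 M N :=
  ((fourierL2 M N).symm : L2 M N →L[ℂ] L2 M N) ∘L
    ((ContinuousLinearMap.lsmul ℂ ℂ (E := CMat M N)).holderL volume ∞ 2 2 heaviside) ∘L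
      (fourierL2 M N : L2 M N →L[ℂ] L2 M N)

/-- The range of the Szegő projector. -/
def szegoRange (M N : ℕ) : Submodule ℂ (L2 M N) := (szego M N : L2 M N →ₗ[ℂ] L2 M N).range

/-- The filtered space `L²_+(ℝ; ℂ^{M × N}) = Π_{≥ 0} (L²(ℝ; ℂ^{M × N}))`, with the inner product
of `L²`. -/
def L2Plus (M N : ℕ) : Type := szegoRange M N

namespace L2Plus

variable {M N : ℕ}

instance : NormedAddCommGroup (L2Plus M N) :=
  inferInstanceAs (NormedAddCommGroup (szegoRange M N))

instance : InnerProductSpace ℂ (L2Plus M N) :=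
  inferInstanceAs (InnerProductSpace ℂ (szegoRange M N))

/-- The inclusion of `L²_+` into `L²`. -/
def toL2 : L2Plus M N →L[ℂ] L2 M N := (szegoRange M N).subtypeL

end L2Plus

/-- The Szegő projector, as a map from `L²` to `L²_+`. -/
def szegoPlus (M N : ℕ) : L2 M N →L[ℂ] L2Plus M N :=
  (szego M N).codRestrict (szegoRange M N) fun f => LinearMap.mem_range_self _ f

/-! ### Sobolev spaces -/

/-- The Japanese bracket to the power `s`, `⟨2 π ξ⟩ ^ s = (1 + (2 π ξ)²)^{s/2}`. The factor `2 π`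
is due to the kernel `exp (-2 π i x ξ)` of the Fourier transform. -/
def bracket (s ξ : ℝ) : ℝ := (1 + (2 * Real.pi * ξ) ^ 2) ^ (s / 2)

/-- The functions `f ∈ L²(ℝ; ℂ^{M × N})` such that `⟨D⟩^s f ∈ L²`. -/
def sobolevSubmodule (s : ℝ) (M N : ℕ) : Submodule ℂ (L2 M N) where
  carrier := {f | MemLp (fun ξ => bracket s ξ • fourierL2 M N f ξ) 2 volume}
  zero_mem' := by
    simp only [Set.mem_ofPred_eq, map_zero]
    refine MemLp.zero.ae_eq (f := 0) ?_
    filter_upwards [Lp.coeFn_zero (CMat M N) 2 (volume : Measure ℝ)] with ξ hξ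
    simp only [hξ, Pi.zero_apply, smul_zero]
  add_mem' {f g} hf hg := by
    refine (hf.add hg).ae_eq ?_
    rw [map_add]
    filter_upwards [Lp.coeFn_add (fourierL2 M N f) (fourierL2 M N g)] with ξ hξ
    simp only [hξ, Pi.add_apply, smul_add]
  smul_mem' c f hf := by
    refine (hf.const_smul c).ae_eq ?_
    rw [map_smul]
    filter_upwards [Lp.coeFn_smul c (fourierL2 M N f)] with ξ hξ
    simp only [hξ, Pi.smul_apply, smul_comm c]

lemma memLp_weighted {s : ℝ} {M N : ℕ} (f : sobolevSubmodule s M N) :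
    MemLp (fun ξ => bracket s ξ • fourierL2 M N f ξ) 2 volume := f.2

/-- The map `f ↦ ⟨2 π ξ⟩^s f̂(ξ)`, which defines the norm of `H^s`. -/
def weightedFourier (s : ℝ) (M N : ℕ) : sobolevSubmodule s M N →ₗ[ℂ] L2 M N where
  toFun f := (memLp_weighted f).toLp
  map_add' f g := by
    rw [← MemLp.toLp_add]
    apply MemLp.toLp_congr
    rw [Submodule.coe_add, map_add]
    filter_upwards [Lp.coeFn_add (fourierL2 M N f) (fourierL2 M N g)] with ξ hξ
    simp only [hξ, Pi.add_apply, smul_add]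
  map_smul' c f := by
    rw [RingHom.id_apply, ← MemLp.toLp_const_smul]
    apply MemLp.toLp_congr
    rw [Submodule.coe_smul, map_smul]
    filter_upwards [Lp.coeFn_smul c (fourierL2 M N f)] with ξ hξ
    simp only [hξ, Pi.smul_apply, smul_comm c]

lemma bracket_pos (s ξ : ℝ) : 0 < bracket s ξ := by
  unfold bracket; positivity

lemma weightedFourier_injective (s : ℝ) (M N : ℕ) :
    Function.Injective (weightedFourier s M N) := by
  rw [← LinearMap.ker_eq_bot, LinearMap.ker_eq_bot']
  intro f hf
  have h0 : fourierL2 M N f = 0 := by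
    rw [Lp.eq_zero_iff_ae_eq_zero]
    have h1 : (weightedFourier s M N f : ℝ → CMat M N) =ᵐ[volume]
        fun ξ => bracket s ξ • fourierL2 M N f ξ := MemLp.coeFn_toLp (memLp_weighted f)
    rw [hf] at h1
    filter_upwards [h1, Lp.coeFn_zero (CMat M N) 2 (volume : Measure ℝ)] with ξ h2 h3
    rw [h3] at h2
    exact (smul_eq_zero.mp h2.symm).resolve_left (bracket_pos s ξ).ne'
  simpa using h0

/-- The Sobolev space `H^s(ℝ; ℂ^{M × N})`, for `s ≥ 0`. Its topology is the one of the norm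
below, not the one induced by `L²`. -/
def Hs (s : ℝ) (M N : ℕ) : Type := sobolevSubmodule s M N

namespace Hs

variable {s : ℝ} {M N : ℕ}

/-- The norm of `H^s` is `‖f‖² = ∫ (1 + (2 π ξ)²)^s |f̂(ξ)|² dξ`. -/
instance : NormedAddCommGroup (Hs s M N) :=
  NormedAddCommGroup.induced (sobolevSubmodule s M N) (L2 M N) (weightedFourier s M N)
    (weightedFourier_injective s M N)

instance : NormedSpace ℂ (Hs s M N) :=
  NormedSpace.induced ℂ (sobolevSubmodule s M N) (L2 M N) (weightedFourier s M N)

/-- The inclusion of `H^s` into `L²`. -/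
def toL2 : Hs s M N →ₗ[ℂ] L2 M N := (sobolevSubmodule s M N).subtype

end Hs

/-- The filtered Sobolev space `H^s_+ = Π_{≥ 0} (H^s) = H^s ∩ L²_+`, with the norm of `H^s`. -/
def HsPlus (s : ℝ) (M N : ℕ) : Type := (szegoRange M N).comap (Hs.toL2 : Hs s M N →ₗ[ℂ] L2 M N)

namespace HsPlus

variable {s : ℝ} {M N : ℕ}

instance : NormedAddCommGroup (HsPlus s M N) :=
  inferInstanceAs (NormedAddCommGroup ((szegoRange M N).comap (Hs.toL2 : Hs s M N →ₗ[ℂ] L2 M N)))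

instance : NormedSpace ℂ (HsPlus s M N) :=
  inferInstanceAs (NormedSpace ℂ ((szegoRange M N).comap (Hs.toL2 : Hs s M N →ₗ[ℂ] L2 M N)))

/-- The isometric inclusion of `H^s_+` into `H^s`. -/
def toHs : HsPlus s M N →L[ℂ] Hs s M N :=
  ((szegoRange M N).comap (Hs.toL2 : Hs s M N →ₗ[ℂ] L2 M N)).subtypeL

/-- The inclusion of `H^s_+` into `L²`. -/
def toL2 : HsPlus s M N →ₗ[ℂ] L2 M N := Hs.toL2 ∘ₗ ((toHs (s := s) (M := M) (N := N)).toLinearMap)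

end HsPlus

/-! ### Sobolev embedding: functions of `H^s`, `s > 1/2`, are essentially bounded -/

lemma memLp_two_bracket {s : ℝ} (hs : 1 / 2 < s) :
    MemLp (fun ξ => bracket (-s) ξ) 2 volume := by
  have hc : Continuous fun ξ => bracket (-s) ξ := by
    unfold bracket
    refine Continuous.rpow_const (by fun_prop) fun x => Or.inl (by positivity)
  rw [memLp_two_iff_integrable_sq hc.aestronglyMeasurable]
  have h1 : Integrable (fun x : ℝ => ((1 : ℝ) + ‖x‖ ^ 2) ^ (-(2 * s) / 2)) :=
    integrable_rpow_neg_one_add_norm_sq (by simp; linarith)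
  refine (h1.comp_mul_left' (R := 2 * Real.pi) (by positivity)).congr ?_
  refine Filter.Eventually.of_forall fun ξ => ?_
  simp only [bracket, Real.norm_eq_abs, sq_abs]
  rw [← Real.rpow_mul_natCast (by positivity)]
  congr 1
  push_cast
  ring

lemma memLp_one_fourier {s : ℝ} (hs : 1 / 2 < s) {M N : ℕ} (f : Hs s M N) :
    MemLp (fourierL2 M N f.toL2 : ℝ → CMat M N) 1 volume := by
  have h := MemLp.smul (p := 2) (q := 2) (r := 1) (memLp_weighted f) (memLp_two_bracket hs)
  refine h.ae_eq (Filter.Eventually.of_forall fun ξ => ?_)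
  simp only [Pi.smul_apply', smul_smul]
  have : bracket (-s) ξ * bracket s ξ = 1 := by
    unfold bracket
    rw [← Real.rpow_add (by positivity)]
    simp [neg_div]
  rw [this, one_smul]
  rfl

lemma integral_schwartz_fourierInv {M N : ℕ} (φ : SchwartzMap ℝ ℂ) {g : ℝ → CMat M N}
    (hg : Integrable g) : ∫ x, φ x • 𝓕⁻ g x = ∫ ξ, (𝓕⁻ φ) ξ • g ξ := by
  have h := VectorFourier.integral_fourierIntegral_smul_eq_flip (μ := volume) (ν := volume)
    (L := -(innerₗ ℝ)) (f := φ) (g := g) Real.continuous_fourierChar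
    (continuous_inner (𝕜 := ℝ) (E := ℝ)).neg φ.integrable hg
  have hfl : (-(innerₗ ℝ)).flip = -(innerₗ ℝ) := by
    ext; simp
  rw [hfl] at h
  rw [SchwartzMap.fourierInv_coe]
  exact h.symm

lemma Hs.memLp_top {s : ℝ} (hs : 1 / 2 < s) {M N : ℕ} (f : Hs s M N) :
    MemLp (f.toL2 : ℝ → CMat M N) ∞ volume := by
  have hg := memLp_one_fourier hs f
  have hb : MemLp (𝓕⁻ (fourierL2 M N f.toL2 : ℝ → CMat M N)) ∞ volume := by
    rw [← Real.Lp.fourierTransformInv_toLp hg]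
    exact BoundedContinuousFunction.memLp_top _
  refine hb.ae_eq ?_
  refine ae_eq_of_integral_contDiff_smul_eq (hb.locallyIntegrable le_top)
    ((Lp.memLp _).locallyIntegrable one_le_two) fun g hg1 hg2 => ?_
  have hg₁ : HasCompactSupport (Complex.ofRealCLM ∘ g) := hg2.comp_left rfl
  have hg₂ : ContDiff ℝ ∞ (Complex.ofRealCLM ∘ g) := by fun_prop
  set φ : SchwartzMap ℝ ℂ := hg₁.toSchwartzMap hg₂
  have hφ : ∀ (h : ℝ → CMat M N), ∫ x, g x • h x = ∫ x, φ x • h x := fun h => by simp [φ]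
  rw [hφ, hφ, integral_schwartz_fourierInv φ (memLp_one_iff_integrable.mp hg),
    ← Lp.toTemperedDistribution_apply, ← Lp.toTemperedDistribution_apply]
  have h := Lp.fourierInv_toTemperedDistribution_eq (fourierL2 M N f.toL2)
  have h' : 𝓕⁻ (fourierL2 M N f.toL2) = f.toL2 :=
    (fourierL2 M N).symm_apply_apply _
  rw [h'] at h
  rw [← h]
  rfl

/-- An element of `H^s_+`, `s > 1/2`, as an element of `L^∞`. -/
def HsPlus.toLinf {s : ℝ} (hs : 1 / 2 < s) {M N : ℕ} (U : HsPlus s M N) : Linf M N :=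
  (Hs.memLp_top hs (toHs U)).toLp

/-- The symbol `U U^* ∈ L^∞(ℝ; ℂ^{M × M})`. -/
def HsPlus.mulAdj {s : ℝ} (hs : 1 / 2 < s) {M N : ℕ} (U : HsPlus s M N) : Linf M M :=
  mulLp (toLinf hs U) (adjLp ∞ M N (toLinf hs U))

/-- The symbol `U^* U ∈ L^∞(ℝ; ℂ^{N × N})`. -/
def HsPlus.adjMul {s : ℝ} (hs : 1 / 2 < s) {M N : ℕ} (U : HsPlus s M N) : Linf N N :=
  mulLp (adjLp ∞ M N (toLinf hs U)) (toLinf hs U)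

/-- The nonlinearity `U U^* U ∈ L²(ℝ; ℂ^{M × N})`. -/
def HsPlus.cubic {s : ℝ} (hs : 1 / 2 < s) {M N : ℕ} (U : HsPlus s M N) : L2 M N :=
  mulLp (mulAdj hs U) (toL2 U)

/-! ### Hankel and Toeplitz operators with essentially bounded symbols -/

/-- The right Hankel operator `F ↦ Π_{≥ 0} (U F^*)`, which is antilinear. -/
def hankelR {M N : ℕ} (d : ℕ) (U : Linf M N) : L2Plus d N →L⋆[ℂ] L2Plus M d :=
  (szegoPlus M d).comp
    ((mulLp U : L2 N d →L[ℂ] L2 M d).comp ((adjLp 2 d N).comp L2Plus.toL2))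

/-- The left Hankel operator `G ↦ Π_{≥ 0} (G^* U)`, which is antilinear. -/
def hankelL {M N : ℕ} (d : ℕ) (U : Linf M N) : L2Plus M d →L⋆[ℂ] L2Plus d N :=
  (szegoPlus d N).comp
    ((mulLp.flip U : L2 d M →L[ℂ] L2 d N).comp ((adjLp 2 M d).comp L2Plus.toL2))

/-- The right Toeplitz operator `G ↦ Π_{≥ 0} (V G)`. -/
def toeplitzR {M N : ℕ} (d : ℕ) (V : Linf M N) : L2Plus N d →L[ℂ] L2Plus M d :=
  (szegoPlus M d).comp ((mulLp V : L2 N d →L[ℂ] L2 M d).comp L2Plus.toL2)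

/-- The left Toeplitz operator `F ↦ Π_{≥ 0} (F V)`. -/
def toeplitzL {M N : ℕ} (d : ℕ) (V : Linf M N) : L2Plus d M →L[ℂ] L2Plus d N :=
  (szegoPlus d N).comp ((mulLp.flip V : L2 d M →L[ℂ] L2 d N).comp L2Plus.toL2)

/-- The double Hankel operator `H^{(r)}_U H^{(l)}_U` on `L²_+(ℝ; ℂ^{M × d})`, for `U ∈ H^s_+`. -/
def doubleHankelRL (d : ℕ) {s : ℝ} (hs : 1 / 2 < s) {M N : ℕ} (U : HsPlus s M N) :
    L2Plus M d →L[ℂ] L2Plus M d :=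
  (hankelR d (U.toLinf hs)).comp (hankelL d (U.toLinf hs))

/-- The double Hankel operator `H^{(l)}_U H^{(r)}_U` on `L²_+(ℝ; ℂ^{d × N})`, for `U ∈ H^s_+`. -/
def doubleHankelLR (d : ℕ) {s : ℝ} (hs : 1 / 2 < s) {M N : ℕ} (U : HsPlus s M N) :
    L2Plus d N →L[ℂ] L2Plus d N :=
  (hankelL d (U.toLinf hs)).comp (hankelR d (U.toLinf hs))

/-- `U` solves the cubic matrix Szegő equation `i ∂_t U = Π_{≥ 0} (U U^* U)` on `ℝ × ℝ`, the time
derivative being taken in `H^s_+`. -/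
def SolvesSzego {s : ℝ} (hs : 1 / 2 < s) {M N : ℕ} (U : ℝ → HsPlus s M N) : Prop :=
  ∀ t : ℝ, DifferentiableAt ℝ U t ∧
    I • (deriv U t).toL2 = szego M N (U t |>.cubic hs)

end MatrixSzego

end

/-!
The double Hankel operators are real-bilinear in `U`, and a function of `H^s`, `s > 1/2`, is bounded
by a multiple of its `H^s` norm. So they are smooth in time, and by the product rule the derivative
of `H^{(r)}_U H^{(l)}_U` is `H^{(r)}_U H^{(l)}_{U'} + H^{(r)}_{U'} H^{(l)}_U`.

With `V = i U' = Π (U U^* U)`, the Hankel operator of `V` is computed by splitting off negative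
frequencies. Modulo functions with spectrum in `(-∞, 0]`, `V F^*` is `U U^* (U F^*)`. Writing
`U F^* = Π (U F^*) + Y`, the first part gives `T^{(r)}_{U U^*} H^{(r)}_U F`. The second one gives
`Π (U (Y^* U)^*)`, where `Y^* U` has nonnegative spectrum, so that
`Y^* U = Π (Y^* U) = T^{(l)}_{U^* U} F - H^{(l)}_U H^{(r)}_U F`. This is `hankelR_cubic`,
`H^{(r)}_V = T^{(r)}_{U U^*} H^{(r)}_U + H^{(r)}_U T^{(l)}_{U^* U}
  - H^{(r)}_U H^{(l)}_U H^{(r)}_U`,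
and `hankelL_cubic` is its mirror image. In the product rule the antilinearity of the Hankel
operators turns the sum into a difference, in which all terms but the commutator cancel.

The analytic input is `SpecVanish.mul`: a product of two `L²` functions with spectrum in `(-∞, 0]`
has spectrum in `(-∞, 0]`, provided it belongs to `L²`. It is proved by testing the product against
Fourier transforms of Schwartz functions supported in `(0, ∞)`, which can be absorbed into one
factor, and then using Plancherel's identity.
-/

noncomputable section

namespace MatrixSzego

/-! ### Functions whose Fourier transform vanishes on an open set -/

lemma integrable_schwartz_smul {E : Type*} [NormedAddCommGroup E] [NormedSpace ℂ E]
    (φ : SchwartzMap ℝ ℂ) (f : Lp E 2 (volume : Measure ℝ)) :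
    Integrable fun x => φ x • f x :=
  memLp_one_iff_integrable.mp (MemLp.smul (p := 2) (q := 2) (r := 1) (Lp.memLp f) (φ.memLp 2))

section SpecVanish

variable {E F : Type*} [NormedAddCommGroup E] [InnerProductSpace ℂ E] [CompleteSpace E]
  [NormedAddCommGroup F] [InnerProductSpace ℂ F] [CompleteSpace F] {S : Set ℝ}

/-- The Fourier transform of `f ∈ L²(ℝ; E)` vanishes almost everywhere on `S`. -/
def SpecVanish (S : Set ℝ) (f : Lp E 2 (volume : Measure ℝ)) : Prop :=
  ∀ᵐ ξ, ξ ∈ S → (𝓕 f : Lp E 2 (volume : Measure ℝ)) ξ = 0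

lemma integral_fourier_smul_Lp (ψ : SchwartzMap ℝ ℂ) (f : Lp E 2 (volume : Measure ℝ)) :
    ∫ x, (𝓕 ψ) x • f x = ∫ ξ, ψ ξ • (𝓕 f : Lp E 2 (volume : Measure ℝ)) ξ := by
  have h := congrArg (fun T => T ψ) (Lp.fourier_toTemperedDistribution_eq f)
  simpa [Lp.toTemperedDistribution_apply, TemperedDistribution.fourier_apply] using h

/-- Vanishing of the Fourier transform on an open set is tested against Fourier transforms of
Schwartz functions. Unlike the definition, this criterion passes through linear and antilinear
maps acting on the values. -/
lemma specVanish_iff (hS : IsOpen S) (f : Lp E 2 (volume : Measure ℝ)) :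
    SpecVanish S f ↔ ∀ ψ : SchwartzMap ℝ ℂ, Function.support ψ ⊆ S →
      ∫ x, (𝓕 ψ) x • f x = 0 := by
  constructor
  · intro h ψ hψ
    rw [integral_fourier_smul_Lp]
    refine integral_eq_zero_of_ae ?_
    filter_upwards [h] with ξ hξ
    by_cases hξS : ξ ∈ S
    · simp [hξ hξS]
    · have : ψ ξ = 0 := by
        by_contra h0
        exact hξS (hψ h0)
      simp [this]
  · intro h
    refine hS.ae_eq_zero_of_integral_contDiff_smul_eq_zero
      ((Lp.memLp _).locallyIntegrable one_le_two |>.locallyIntegrableOn _) fun g hg1 hg2 hg3 => ?_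
    have hg₁ : HasCompactSupport (Complex.ofRealCLM ∘ g) := hg2.comp_left rfl
    have hg₂ : ContDiff ℝ ∞ (Complex.ofRealCLM ∘ g) := by fun_prop
    have h0 := h (hg₁.toSchwartzMap hg₂) (by
      intro x hx
      refine hg3 (subset_tsupport _ ?_)
      intro h0
      simp [h0] at hx)
    rw [integral_fourier_smul_Lp] at h0
    simpa using h0

lemma SpecVanish.compLp (hS : IsOpen S) {f : Lp E 2 (volume : Measure ℝ)} (hf : SpecVanish S f)
    (L : E →L[ℂ] F) : SpecVanish S (L.compLp f) := by
  rw [specVanish_iff hS] at hf ⊢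
  intro ψ hψ
  have e : ∫ x, (𝓕 ψ) x • (L.compLp f) x = ∫ x, L ((𝓕 ψ) x • f x) := by
    refine integral_congr_ae ?_
    filter_upwards [L.coeFn_compLp f] with x hx
    rw [hx, map_smul]
  rw [e, L.integral_comp_comm (integrable_schwartz_smul _ f), hf ψ hψ, map_zero]

/-- The reflected conjugate `ξ ↦ conj (ψ (-ξ))` of a Schwartz function, whose Fourier transform
is the conjugate of that of `ψ`. -/
def conjReflect (ψ : SchwartzMap ℝ ℂ) : SchwartzMap ℝ ℂ :=
  SchwartzMap.postcompCLM (𝕜 := ℝ) (Complex.conjCLE : ℂ →L[ℝ] ℂ)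
    (SchwartzMap.compCLMOfContinuousLinearEquiv ℝ (ContinuousLinearEquiv.neg ℝ) ψ)

lemma conjReflect_apply (ψ : SchwartzMap ℝ ℂ) (ξ : ℝ) : conjReflect ψ ξ = conj (ψ (-ξ)) := by
  simp [conjReflect]

lemma fourier_conjReflect (ψ : SchwartzMap ℝ ℂ) (x : ℝ) :
    (𝓕 (conjReflect ψ)) x = conj ((𝓕 ψ) x) := by
  rw [SchwartzMap.fourier_coe, SchwartzMap.fourier_coe, Real.fourier_eq, Real.fourier_eq,
    ← integral_conj, ← integral_neg_eq_self]
  refine integral_congr_ae (Filter.Eventually.of_forall fun v => ?_)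
  simp only [conjReflect_apply, neg_neg, Circle.smul_def, smul_eq_mul, map_mul, inner_neg_left]
  rw [← Circle.coe_inv_eq_conj, ← AddChar.map_neg_eq_inv, neg_neg]

/-- An antilinear map acting on the values reflects the frequencies. -/
lemma SpecVanish.compLp_conj (hS : IsOpen S) {f : Lp E 2 (volume : Measure ℝ)}
    (hf : SpecVanish (-S) f) (L : E →L⋆[ℂ] F) : SpecVanish S (L.compLp f) := by
  rw [specVanish_iff hS]
  rw [specVanish_iff hS.neg] at hf
  intro ψ hψ
  -- over `ℝ`, the antilinear map `L` is linear and commutes with the integral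
  let L' : E →L[ℝ] F :=
    { toFun := L
      map_add' := L.map_add
      map_smul' := fun c x => by
        have := L.map_smulₛₗ (c : ℂ) x
        simpa using this
      cont := L.continuous }
  have e : ∫ x, (𝓕 ψ) x • (L.compLp f) x = ∫ x, L' ((𝓕 (conjReflect ψ)) x • f x) := by
    refine integral_congr_ae ?_
    filter_upwards [L.coeFn_compLp f] with x hx
    rw [hx, fourier_conjReflect]
    exact ((L.map_smulₛₗ _ _).trans (by simp)).symm
  rw [e, L'.integral_comp_comm (integrable_schwartz_smul _ f), hf _ ?_, map_zero]
  intro ξ hξ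
  refine hψ fun h0 => hξ ?_
  rw [conjReflect_apply, h0, map_zero]

end SpecVanish

/-! ### Products of functions with one-sided spectrum -/

lemma neg_Iio_zero : -Set.Iio (0 : ℝ) = Set.Ioi 0 := by simp

lemma neg_Ioi_zero : -Set.Ioi (0 : ℝ) = Set.Iio 0 := by simp

/-- By Plancherel, `∫ f g = ⟪conj f, g⟫` vanishes since the Fourier transforms of `conj f` and `g`
have essentially disjoint supports. -/
lemma SpecVanish.integral_mul_eq_zero {f g : Lp ℂ 2 (volume : Measure ℝ)}
    (hf : SpecVanish (Set.Ioi 0) f) (hg : SpecVanish (Set.Ioi 0) g) :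
    ∫ x, f x * g x = 0 := by
  let C : ℂ →L⋆[ℂ] ℂ := (starL ℂ : ℂ ≃L⋆[ℂ] ℂ)
  have hC : ∀ z, C z = conj z := fun z => rfl
  have h1 : SpecVanish (Set.Iio 0) (C.compLp f) :=
    SpecVanish.compLp_conj isOpen_Iio (by rwa [neg_Iio_zero]) C
  have e : ∫ x, f x * g x = inner ℂ (C.compLp f) g := by
    rw [L2.inner_def]
    refine integral_congr_ae ?_
    filter_upwards [C.coeFn_compLp f] with x hx
    rw [hx, hC, RCLike.inner_apply, RingHomCompTriple.comp_apply, RingHom.id_apply, mul_comm]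
  rw [e, ← Lp.inner_fourier_eq, L2.inner_def]
  refine integral_eq_zero_of_ae ?_
  filter_upwards [h1, hg, Measure.ae_ne volume (0 : ℝ)] with ξ h1 h2 h3
  rcases lt_or_gt_of_ne h3 with h | h
  · rw [h1 h, inner_zero_left, Pi.zero_apply]
  · rw [h2 h, inner_zero_right, Pi.zero_apply]

/-- The product of a Schwartz function and an `L²` function. -/
def schwartzMul (φ : SchwartzMap ℝ ℂ) (f : Lp ℂ 2 (volume : Measure ℝ)) :
    Lp ℂ 2 (volume : Measure ℝ) :=
  (MemLp.smul (p := ∞) (q := 2) (r := 2) (Lp.memLp f) (φ.memLp ∞)).toLp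

lemma coeFn_schwartzMul (φ : SchwartzMap ℝ ℂ) (f : Lp ℂ 2 (volume : Measure ℝ)) :
    schwartzMul φ f =ᵐ[volume] fun x => φ x * f x :=
  MemLp.coeFn_toLp _

/-- Multiplication by the Fourier transform of a Schwartz function supported in `(0, ∞)`
convolves the spectrum with a function supported in `(-∞, 0)`. -/
lemma SpecVanish.fourier_mul {f : Lp ℂ 2 (volume : Measure ℝ)} (hf : SpecVanish (Set.Ioi 0) f)
    {ψ : SchwartzMap ℝ ℂ} (hψ : Function.support ψ ⊆ Set.Ioi 0) :
    SpecVanish (Set.Ioi 0) (schwartzMul (𝓕 ψ) f) := by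
  rw [specVanish_iff isOpen_Ioi] at hf ⊢
  intro χ hχ
  let B : ℂ →L[ℂ] ℂ →L[ℂ] ℂ := ContinuousLinearMap.mul ℂ ℂ
  rw [← hf (SchwartzMap.convolution B ψ χ) ?_]
  · refine integral_congr_ae ?_
    filter_upwards [coeFn_schwartzMul (𝓕 ψ) f] with x hx
    rw [hx, SchwartzMap.fourier_convolution, SchwartzMap.pairing_apply_apply]
    simp only [B, ContinuousLinearMap.mul_apply', smul_eq_mul]
    ring
  · intro ξ hξ
    rw [Function.mem_support, SchwartzMap.convolution_apply] at hξ
    obtain ⟨a, ha, b, hb, rfl⟩ := support_convolution_subset B hξ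
    exact add_pos (Set.mem_Ioi.mp (hψ ha)) (Set.mem_Ioi.mp (hχ hb))

lemma integrable_mul_Lp (f g : Lp ℂ 2 (volume : Measure ℝ)) : Integrable fun x => f x * g x :=
  memLp_one_iff_integrable.mp (MemLp.smul (p := 2) (q := 2) (r := 1) (Lp.memLp g) (Lp.memLp f))

section Projector

/-! ### The Szegő projector -/

variable {M N P : ℕ}

lemma coeFn_heaviside :
    heaviside =ᵐ[volume] (Set.Ici (0 : ℝ)).indicator fun _ => (1 : ℂ) :=
  MemLp.coeFn_toLp _

lemma coeFn_fourier_szego (f : L2 M N) :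
    (𝓕 (szego M N f) : L2 M N) =ᵐ[volume]
      (Set.Ici (0 : ℝ)).indicator (𝓕 f : L2 M N) := by
  have e : (𝓕 (szego M N f) : L2 M N) =
      (ContinuousLinearMap.lsmul ℂ ℂ (E := CMat M N)).holder 2 heaviside (𝓕 f : L2 M N) :=
    (fourierL2 M N).apply_symm_apply _
  rw [e]
  filter_upwards [ContinuousLinearMap.coeFn_holder (r := 2)
    (ContinuousLinearMap.lsmul ℂ ℂ (E := CMat M N)) heaviside (𝓕 f : L2 M N),
    coeFn_heaviside] with ξ h1 h2
  rw [h1, h2]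
  by_cases h : ξ ∈ Set.Ici (0 : ℝ) <;> simp only [Set.indicator_of_mem, Set.indicator_of_notMem, h,
    not_false_eq_true, ContinuousLinearMap.lsmul_apply, one_smul, zero_smul]

lemma specVanish_szego (f : L2 M N) : SpecVanish (Set.Iio 0) (szego M N f) := by
  filter_upwards [coeFn_fourier_szego f] with ξ h1 h2
  rw [h1, Set.indicator_of_notMem (by simpa using h2)]

lemma specVanish_of_mem_szegoRange {f : L2 M N} (hf : f ∈ szegoRange M N) :
    SpecVanish (Set.Iio 0) f := by
  obtain ⟨g, rfl⟩ := hf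
  exact specVanish_szego g

lemma L2Plus.specVanish (F : L2Plus M N) : SpecVanish (Set.Iio 0) F.toL2 :=
  specVanish_of_mem_szegoRange F.2

lemma fourier_injective {f g : L2 M N} (h : (𝓕 f : L2 M N) = 𝓕 g) : f = g :=
  (fourierL2 M N).injective h

lemma szego_eq_self {f : L2 M N} (hf : SpecVanish (Set.Iio 0) f) : szego M N f = f := by
  refine fourier_injective (Lp.ext ?_)
  filter_upwards [coeFn_fourier_szego f, hf] with ξ h1 h2
  rw [h1]
  by_cases h : 0 ≤ ξ
  · rw [Set.indicator_of_mem (by simpa using h)]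
  · rw [Set.indicator_of_notMem (by simpa using h), h2 (by simpa using h)]

lemma szego_eq_zero {f : L2 M N} (hf : SpecVanish (Set.Ioi 0) f) : szego M N f = 0 := by
  have h0 : (𝓕 (0 : L2 M N) : L2 M N) = 0 := (fourierL2 M N).map_zero
  refine fourier_injective (Lp.ext ?_)
  rw [h0]
  filter_upwards [coeFn_fourier_szego f, hf, Measure.ae_ne volume (0 : ℝ),
    Lp.coeFn_zero (CMat M N) 2 (volume : Measure ℝ)] with ξ h1 h2 h3 h4
  rw [h1, h4, Pi.zero_apply]
  by_cases h : 0 ≤ ξ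
  · rw [Set.indicator_of_mem (by simpa using h), h2 (lt_of_le_of_ne h (Ne.symm h3))]
  · rw [Set.indicator_of_notMem (by simpa using h)]

lemma specVanish_sub_szego (f : L2 M N) : SpecVanish (Set.Ioi 0) (f - szego M N f) := by
  have e : (𝓕 (f - szego M N f) : L2 M N) = 𝓕 f - 𝓕 (szego M N f) :=
    (fourierL2 M N).map_sub _ _
  unfold SpecVanish
  rw [e]
  filter_upwards [coeFn_fourier_szego f,
    Lp.coeFn_sub (𝓕 f : L2 M N) (𝓕 (szego M N f))] with ξ h1 h2 h3
  rw [h2, Pi.sub_apply, h1, Set.indicator_of_mem (Set.mem_Ici.mpr (le_of_lt h3)), sub_self]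

/-! ### Pointwise products and adjoints -/

lemma coeFn_mulLp {p q r : ℝ≥0∞} [ENNReal.HolderTriple p q r]
    [Fact (1 ≤ p)] [Fact (1 ≤ q)] [Fact (1 ≤ r)] (f : LpMat p M N) (g : LpMat q N P) :
    (mulLp f g : LpMat r M P) =ᵐ[volume] fun x => CMat.mulL M N P (f x) (g x) :=
  ContinuousLinearMap.coeFn_holder _ f g

lemma coeFn_adjLp {p : ℝ≥0∞} [Fact (1 ≤ p)] (f : LpMat p M N) :
    adjLp p M N f =ᵐ[volume] fun x => CMat.adjL M N (f x) :=
  ContinuousLinearMap.coeFn_compLpL _ f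

lemma CMat.mulL_apply (A : CMat M N) (B : CMat N P) (i : Fin M) (j : Fin P) :
    CMat.mulL M N P A B (i, j) = ∑ k, A (i, k) * B (k, j) := by
  simp [CMat.mulL, CMat.ofMatrix, CMat.toMatrix, Matrix.mul_apply]

lemma CMat.adjL_apply (A : CMat M N) (i : Fin N) (j : Fin M) :
    CMat.adjL M N A (i, j) = conj (A (j, i)) := by
  simp [CMat.adjL, CMat.ofMatrix, CMat.toMatrix]

lemma CMat.mulL_assoc {Q : ℕ} (A : CMat M N) (B : CMat N P) (C : CMat P Q) :
    CMat.mulL M P Q (CMat.mulL M N P A B) C = CMat.mulL M N Q A (CMat.mulL N P Q B C) := by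
  ext ⟨i, j⟩
  simp only [CMat.mulL_apply, Finset.sum_mul, Finset.mul_sum, mul_assoc]
  exact Finset.sum_comm

lemma CMat.adjL_mulL (A : CMat M N) (B : CMat N P) :
    CMat.adjL M P (CMat.mulL M N P A B) = CMat.mulL P N M (CMat.adjL N P B) (CMat.adjL M N A) := by
  ext ⟨i, j⟩
  simp only [CMat.mulL_apply, CMat.adjL_apply, map_sum, map_mul, mul_comm]

lemma CMat.adjL_adjL (A : CMat M N) : CMat.adjL N M (CMat.adjL M N A) = A := by
  ext ⟨i, j⟩
  simp only [CMat.adjL_apply, conj_conj]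

lemma SpecVanish.adj {S : Set ℝ} (hS : IsOpen S) {f : L2 M N} (hf : SpecVanish (-S) f) :
    SpecVanish S (adjLp 2 M N f) :=
  SpecVanish.compLp_conj hS hf (CMat.adjL M N)

lemma L2Plus.specVanish_adj (F : L2Plus M N) : SpecVanish (Set.Ioi 0) (adjLp 2 M N F.toL2) :=
  SpecVanish.adj isOpen_Ioi (by rw [neg_Ioi_zero]; exact F.specVanish)

/-- Functions with spectrum in `(-∞, 0]` are stable under products, as long as these stay
in `L²`. -/
lemma SpecVanish.mul {f : L2 M N} {g : L2 N P} {h : L2 M P} (hf : SpecVanish (Set.Ioi 0) f)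
    (hg : SpecVanish (Set.Ioi 0) g)
    (hfg : h =ᵐ[volume] fun x => CMat.mulL M N P (f x) (g x)) : SpecVanish (Set.Ioi 0) h := by
  rw [specVanish_iff isOpen_Ioi]
  intro ψ hψ
  let π {M N : ℕ} (p : Fin M × Fin N) : CMat M N →L[ℂ] ℂ := EuclideanSpace.proj p
  have hπ : ∀ {M N : ℕ} (p : Fin M × Fin N) (A : CMat M N), π p A = A p := fun p A => rfl
  have hi : ∀ (i : Fin M) (j : Fin P) (k : Fin N), Integrable fun x =>
      schwartzMul (𝓕 ψ) ((π (i, k)).compLp f) x * (π (k, j)).compLp g x :=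
    fun i j k => integrable_mul_Lp _ _
  ext ⟨i, j⟩
  rw [← hπ, ← (π (i, j)).integral_comp_comm (integrable_schwartz_smul _ _)]
  trans ∫ x, ∑ k, schwartzMul (𝓕 ψ) ((π (i, k)).compLp f) x * (π (k, j)).compLp g x
  · refine integral_congr_ae ?_
    have e1 : ∀ᵐ x, ∀ k, schwartzMul (𝓕 ψ) ((π (i, k)).compLp f) x = (𝓕 ψ) x * f x (i, k) := by
      refine ae_all_iff.mpr fun k => ?_
      filter_upwards [coeFn_schwartzMul (𝓕 ψ) ((π (i, k)).compLp f), (π (i, k)).coeFn_compLp f]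
        with x h1 h2
      rw [h1, h2, hπ]
    have e2 : ∀ᵐ x, ∀ k, (π (k, j)).compLp g x = g x (k, j) :=
      ae_all_iff.mpr fun k => (π (k, j)).coeFn_compLp g
    filter_upwards [hfg, e1, e2] with x h1 h2 h3
    simp only [h1, h2, h3, PiLp.smul_apply, hπ, CMat.mulL_apply, smul_eq_mul,
      Finset.mul_sum, mul_assoc]
  · rw [integral_finsetSum _ fun k _ => hi i j k]
    refine Finset.sum_eq_zero fun k _ => ?_
    exact ((hf.compLp isOpen_Ioi _).fourier_mul hψ).integral_mul_eq_zero (hg.compLp isOpen_Ioi _)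

end Projector

section HankelAlgebra

/-! ### Algebra of Hankel and Toeplitz operators -/

variable {M N P : ℕ}

lemma mulLp_assoc {Q : ℕ} {p q r a b c : ℝ≥0∞} [Fact (1 ≤ p)] [Fact (1 ≤ q)] [Fact (1 ≤ r)]
    [Fact (1 ≤ a)] [Fact (1 ≤ b)] [Fact (1 ≤ c)] [ENNReal.HolderTriple p q a]
    [ENNReal.HolderTriple a r c] [ENNReal.HolderTriple q r b] [ENNReal.HolderTriple p b c]
    (f : LpMat p M N) (g : LpMat q N P) (h : LpMat r P Q) :
    (mulLp (mulLp f g : LpMat a M P) h : LpMat c M Q) = mulLp f (mulLp g h : LpMat b N Q) := by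
  refine Lp.ext ?_
  filter_upwards [coeFn_mulLp (r := c) (mulLp f g : LpMat a M P) h, coeFn_mulLp (r := a) f g,
    coeFn_mulLp (r := c) f (mulLp g h : LpMat b N Q), coeFn_mulLp (r := b) g h] with x h1 h2 h3 h4
  rw [h1, h2, h3, h4, CMat.mulL_assoc]

lemma adjLp_mulLp {p q r : ℝ≥0∞} [Fact (1 ≤ p)] [Fact (1 ≤ q)] [Fact (1 ≤ r)]
    [ENNReal.HolderTriple p q r] [ENNReal.HolderTriple q p r]
    (f : LpMat p M N) (g : LpMat q N P) :
    adjLp r M P (mulLp f g) = mulLp (adjLp q N P g) (adjLp p M N f) := by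
  refine Lp.ext ?_
  filter_upwards [coeFn_adjLp (mulLp f g : LpMat r M P), coeFn_mulLp (r := r) f g,
    coeFn_mulLp (r := r) (adjLp q N P g) (adjLp p M N f), coeFn_adjLp f, coeFn_adjLp g]
    with x h1 h2 h3 h4 h5
  rw [h1, h2, h3, h4, h5, CMat.adjL_mulL]

lemma adjLp_adjLp {p : ℝ≥0∞} [Fact (1 ≤ p)] (f : LpMat p M N) :
    adjLp p N M (adjLp p M N f) = f := by
  refine Lp.ext ?_
  filter_upwards [coeFn_adjLp (adjLp p M N f), coeFn_adjLp f] with x h1 h2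
  rw [h1, h2, CMat.adjL_adjL]

/-- The product of an essentially bounded function and an `L²` function, both with spectrum in
`(-∞, 0]`. The bounded factor has a spectrum through its `L²` version `u'`. -/
lemma SpecVanish.mulLp_left {u : Linf M N} {u' : L2 M N} (hu : u' =ᵐ[volume] u)
    (hu' : SpecVanish (Set.Ioi 0) u') {f : L2 N P} (hf : SpecVanish (Set.Ioi 0) f) :
    SpecVanish (Set.Ioi 0) (mulLp u f : L2 M P) := by
  refine hu'.mul hf ?_
  filter_upwards [coeFn_mulLp (r := 2) u f, hu] with x h1 h2
  rw [h1, h2]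

lemma SpecVanish.mulLp_right {u : Linf N P} {u' : L2 N P} (hu : u' =ᵐ[volume] u)
    (hu' : SpecVanish (Set.Ioi 0) u') {f : L2 M N} (hf : SpecVanish (Set.Ioi 0) f) :
    SpecVanish (Set.Ioi 0) (mulLp f u : L2 M P) := by
  refine hf.mul hu' ?_
  filter_upwards [coeFn_mulLp (r := 2) f u, hu] with x h1 h2
  rw [h1, h2]

lemma adjLp_ae_eq {u : Linf M N} {u' : L2 M N} (hu : u' =ᵐ[volume] u) :
    adjLp 2 M N u' =ᵐ[volume] adjLp ∞ M N u := by
  filter_upwards [coeFn_adjLp u', coeFn_adjLp u, hu] with x h1 h2 h3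
  rw [h1, h2, h3]

lemma L2Plus.ext {F G : L2Plus M N} (h : F.toL2 = G.toL2) : F = G := Subtype.ext h

lemma toL2_hankelR (d : ℕ) (u : Linf M N) (F : L2Plus d N) :
    (hankelR d u F).toL2 = szego M d (mulLp u (adjLp 2 d N F.toL2)) := rfl

lemma toL2_hankelL (d : ℕ) (u : Linf M N) (G : L2Plus M d) :
    (hankelL d u G).toL2 = szego d N (mulLp (adjLp 2 M d G.toL2) u) := rfl

lemma toL2_toeplitzR (d : ℕ) (v : Linf M N) (G : L2Plus N d) :
    (toeplitzR d v G).toL2 = szego M d (mulLp v G.toL2) := rfl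

lemma toL2_toeplitzL (d : ℕ) (v : Linf M N) (F : L2Plus d M) :
    (toeplitzL d v F).toL2 = szego d N (mulLp F.toL2 v) := rfl

variable {d : ℕ} {u v : Linf M N} {u' z : L2 M N}

/-- Hankel operators do not see the part of their symbol with spectrum in `(-∞, 0]`. -/
lemma szego_mulLp_adj_congr {w : Linf M N} (hz : z =ᵐ[volume] fun x => w x - v x)
    (hz' : SpecVanish (Set.Ioi 0) z) (F : L2Plus d N) :
    szego M d (mulLp v (adjLp 2 d N F.toL2)) = szego M d (mulLp w (adjLp 2 d N F.toL2)) := by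
  rw [eq_comm, ← sub_eq_zero, ← map_sub, ← sub_apply, ← map_sub]
  refine szego_eq_zero (SpecVanish.mulLp_left ?_ hz' F.specVanish_adj)
  filter_upwards [hz, Lp.coeFn_sub w v] with x h1 h2
  rw [h1, h2, Pi.sub_apply]

lemma szego_adj_mulLp_congr {w : Linf M N} (hz : z =ᵐ[volume] fun x => w x - v x)
    (hz' : SpecVanish (Set.Ioi 0) z) (G : L2Plus M d) :
    szego d N (mulLp (adjLp 2 M d G.toL2) v) = szego d N (mulLp (adjLp 2 M d G.toL2) w) := by
  rw [eq_comm, ← sub_eq_zero, ← map_sub, ← map_sub]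
  refine szego_eq_zero (SpecVanish.mulLp_right ?_ hz' G.specVanish_adj)
  filter_upwards [hz, Lp.coeFn_sub w v] with x h1 h2
  rw [h1, h2, Pi.sub_apply]

/-- If `v = u u^* u` up to a function with spectrum in `(-∞, 0]`, as is `v = Π (u u^* u)`, then
`H^{(r)}_v = T^{(r)}_{u u^*} H^{(r)}_u + H^{(r)}_u T^{(l)}_{u^* u} - H^{(r)}_u H^{(l)}_u H^{(r)}_u`.
The `L²` functions `u'` and `z` serve to express the spectra of the bounded functions `u` and
`u u^* u - v`. The last two terms come from the part `y = (1 - Π) (u F^*)`, for which `y^* u`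
belongs to `L²_+`. -/
lemma hankelR_cubic (hu : u' =ᵐ[volume] u) (hu' : SpecVanish (Set.Iio 0) u')
    (hz : z =ᵐ[volume] fun x =>
      (mulLp (mulLp u (adjLp ∞ M N u) : Linf M M) u : Linf M N) x - v x)
    (hz' : SpecVanish (Set.Ioi 0) z) (F : L2Plus d N) :
    hankelR d v F = toeplitzR d (mulLp u (adjLp ∞ M N u)) (hankelR d u F)
      + hankelR d u (toeplitzL d (mulLp (adjLp ∞ M N u) u) F)
      - hankelR d u (hankelL d u (hankelR d u F)) := by
  refine L2Plus.ext ?_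
  rw [add_sub_assoc, ← map_sub, map_add]
  simp only [toL2_hankelR, toL2_toeplitzR, toL2_toeplitzL, toL2_hankelL, map_sub]
  rw [szego_mulLp_adj_congr hz hz' F,
    mulLp_assoc (b := 2) (mulLp u (adjLp ∞ M N u)) u]
  set f : L2 d N := F.toL2
  set b : L2 M d := mulLp u (adjLp 2 d N f) with hb
  have hy := specVanish_sub_szego b
  set y : L2 M d := b - szego M d b with hy_def
  have hk : SpecVanish (Set.Iio 0) (mulLp (adjLp 2 M d y) u : L2 d N) := by
    have h := SpecVanish.mulLp_left (adjLp_ae_eq hu)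
      (SpecVanish.adj isOpen_Ioi (by rwa [neg_Ioi_zero])) hy
    have h' := SpecVanish.adj isOpen_Iio (by rwa [neg_Iio_zero]) (f := (mulLp (adjLp ∞ M N u) y))
    rwa [adjLp_mulLp, adjLp_adjLp] at h'
  have hk' : (mulLp (adjLp 2 M d y) u : L2 d N) =
      mulLp f (mulLp (adjLp ∞ M N u) u : Linf N N) - mulLp (adjLp 2 M d (szego M d b)) u := by
    rw [hy_def, map_sub, map_sub, sub_apply]
    congr 1
    rw [hb, adjLp_mulLp, adjLp_adjLp, mulLp_assoc (b := ∞)]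
  have hk'' := szego_eq_self hk
  rw [hk', map_sub, ← hk'] at hk''
  rw [← map_sub, ← map_sub, ← map_sub, hk'', adjLp_mulLp, adjLp_adjLp,
    ← mulLp_assoc (a := ∞) u (adjLp ∞ M N u) y, ← map_add, ← map_add, hy_def, add_sub_cancel]

/-- If `v = u u^* u` up to a function with spectrum in `(-∞, 0]`, then
`H^{(l)}_v = T^{(l)}_{u^* u} H^{(l)}_u + H^{(l)}_u T^{(r)}_{u u^*} - H^{(l)}_u H^{(r)}_u H^{(l)}_u`;
the mirror image of `hankelR_cubic`. -/
lemma hankelL_cubic (hu : u' =ᵐ[volume] u) (hu' : SpecVanish (Set.Iio 0) u')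
    (hz : z =ᵐ[volume] fun x =>
      (mulLp (mulLp u (adjLp ∞ M N u) : Linf M M) u : Linf M N) x - v x)
    (hz' : SpecVanish (Set.Ioi 0) z) (G : L2Plus M d) :
    hankelL d v G = toeplitzL d (mulLp (adjLp ∞ M N u) u) (hankelL d u G)
      + hankelL d u (toeplitzR d (mulLp u (adjLp ∞ M N u)) G)
      - hankelL d u (hankelR d u (hankelL d u G)) := by
  refine L2Plus.ext ?_
  rw [add_sub_assoc, ← map_sub, map_add]
  simp only [toL2_hankelR, toL2_toeplitzR, toL2_toeplitzL, toL2_hankelL, map_sub]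
  rw [szego_adj_mulLp_congr hz hz' G,
    mulLp_assoc (b := ∞) u (adjLp ∞ M N u) u, ← mulLp_assoc (a := 2) (adjLp 2 M d G.toL2) u]
  set g : L2 M d := G.toL2
  set b : L2 d N := mulLp (adjLp 2 M d g) u with hb
  have hy := specVanish_sub_szego b
  set y : L2 d N := b - szego d N b with hy_def
  have hk : SpecVanish (Set.Iio 0) (mulLp u (adjLp 2 d N y) : L2 M d) := by
    have h := SpecVanish.mulLp_right (adjLp_ae_eq hu)
      (SpecVanish.adj isOpen_Ioi (by rwa [neg_Ioi_zero])) hy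
    have h' := SpecVanish.adj isOpen_Iio (by rwa [neg_Iio_zero]) (f := (mulLp y (adjLp ∞ M N u)))
    rwa [adjLp_mulLp, adjLp_adjLp] at h'
  have hk' : (mulLp u (adjLp 2 d N y) : L2 M d) =
      mulLp (mulLp u (adjLp ∞ M N u) : Linf M M) g - mulLp u (adjLp 2 d N (szego d N b)) := by
    rw [hy_def, map_sub, map_sub]
    congr 1
    rw [hb, adjLp_mulLp, adjLp_adjLp, mulLp_assoc (b := 2)]
  have hk'' := szego_eq_self hk
  rw [hk', map_sub, ← hk'] at hk''
  rw [← map_sub, ← sub_apply, ← map_sub, ← map_sub, hk'', adjLp_mulLp, adjLp_adjLp,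
    mulLp_assoc (b := ∞) y (adjLp ∞ M N u) u, ← map_add, ← add_apply, ← map_add, hy_def,
    add_sub_cancel]

end HankelAlgebra

section Continuity

/-! ### Continuity of the Sobolev embedding and of the Hankel operators in their symbol -/

variable {M N : ℕ} {s : ℝ}

/-- Fourier inversion: both sides have the same integrals against test functions. -/
lemma Hs.ae_eq_fourierInv (hs : 1 / 2 < s) (f : Hs s M N) :
    (f.toL2 : ℝ → CMat M N) =ᵐ[volume] 𝓕⁻ (fourierL2 M N f.toL2 : ℝ → CMat M N) := by
  have hg := memLp_one_fourier hs f
  have hb : MemLp (𝓕⁻ (fourierL2 M N f.toL2 : ℝ → CMat M N)) ∞ volume := by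
    rw [← Real.Lp.fourierTransformInv_toLp hg]
    exact BoundedContinuousFunction.memLp_top _
  refine ae_eq_of_integral_contDiff_smul_eq ((Lp.memLp _).locallyIntegrable one_le_two)
    (hb.locallyIntegrable le_top) fun g hg1 hg2 => ?_
  have hg₁ : HasCompactSupport (Complex.ofRealCLM ∘ g) := hg2.comp_left rfl
  have hg₂ : ContDiff ℝ ∞ (Complex.ofRealCLM ∘ g) := by fun_prop
  set φ : SchwartzMap ℝ ℂ := hg₁.toSchwartzMap hg₂
  have hφ : ∀ (h : ℝ → CMat M N), ∫ x, g x • h x = ∫ x, φ x • h x := fun h => by simp [φ]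
  have h' : (𝓕 f.toL2 : L2 M N) = fourierL2 M N f.toL2 := rfl
  rw [hφ, hφ, integral_schwartz_fourierInv φ (memLp_one_iff_integrable.mp hg), ← h',
    ← integral_fourier_smul_Lp, FourierTransform.fourier_fourierInv_eq]

/-- The constant of the Sobolev embedding `H^s ⊂ L^∞`. -/
def sobolevConst (s : ℝ) : ℝ := (eLpNorm (fun ξ => bracket (-s) ξ) 2 volume).toReal

/-- The Sobolev inequality: `‖f‖_∞ ≤ ‖f̂‖₁`, and `f̂ = ⟨ξ⟩^{-s} ⟨ξ⟩^s f̂` is a product of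
`L²` functions. -/
lemma HsPlus.norm_toLinf_le (hs : 1 / 2 < s) (U : HsPlus s M N) :
    ‖U.toLinf hs‖ ≤ sobolevConst s * ‖U‖ := by
  set f : Hs s M N := toHs U
  set g : ℝ → CMat M N := ⇑(fourierL2 M N f.toL2)
  have hg : MemLp g 1 volume := memLp_one_fourier hs f
  have hnorm : ‖U‖ = (eLpNorm (fun ξ => bracket s ξ • g ξ) 2 volume).toReal :=
    Lp.norm_toLp _ (memLp_weighted f)
  have h1 : eLpNorm g 1 volume ≤ eLpNorm (fun ξ => bracket (-s) ξ) 2 volume *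
      eLpNorm (fun ξ => bracket s ξ • g ξ) 2 volume := by
    have h := eLpNorm_smul_le_mul_eLpNorm (p := 2) (q := 2) (r := 1)
      (memLp_weighted f).1 (memLp_two_bracket hs).1
    refine le_trans (le_of_eq (congrArg (eLpNorm · 1 volume) (funext fun ξ => ?_))) h
    have : bracket (-s) ξ * bracket s ξ = 1 := by
      unfold bracket
      rw [← Real.rpow_add (by positivity)]
      simp [neg_div]
    rw [Pi.smul_apply', smul_smul, this, one_smul]
    rfl
  have h2 : (eLpNorm g 1 volume).toReal ≤ sobolevConst s * ‖U‖ := by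
    rw [hnorm, sobolevConst, ← ENNReal.toReal_mul]
    exact ENNReal.toReal_mono (ENNReal.mul_ne_top (memLp_two_bracket hs).2.ne
      (memLp_weighted f).2.ne) h1
  refine le_trans ?_ h2
  rw [Lp.norm_def, eLpNorm_exponent_top]
  refine ENNReal.toReal_le_of_le_ofReal ENNReal.toReal_nonneg (eLpNormEssSup_le_of_ae_bound ?_)
  filter_upwards [MemLp.coeFn_toLp (Hs.memLp_top hs f), Hs.ae_eq_fourierInv hs f] with x h3 h4
  have h5 : U.toLinf hs x = 𝓕⁻ g x := h3.trans h4
  rw [h5, eLpNorm_one_eq_lintegral_enorm, ← integral_norm_eq_lintegral_enorm hg.1]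
  exact VectorFourier.norm_fourierIntegral_le_integral_norm _ _ _ _ _

lemma HsPlus.coeFn_toLinf (hs : 1 / 2 < s) (U : HsPlus s M N) :
    U.toLinf hs =ᵐ[volume] U.toL2 :=
  MemLp.coeFn_toLp _

lemma HsPlus.toLinf_add (hs : 1 / 2 < s) (U V : HsPlus s M N) :
    (U + V).toLinf hs = U.toLinf hs + V.toLinf hs := by
  refine Lp.ext ?_
  filter_upwards [coeFn_toLinf hs (U + V), coeFn_toLinf hs U, coeFn_toLinf hs V,
    Lp.coeFn_add (U.toLinf hs) (V.toLinf hs), Lp.coeFn_add U.toL2 V.toL2] with x h1 h2 h3 h4 h5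
  rw [h1, h4, Pi.add_apply, h2, h3, map_add, h5, Pi.add_apply]

lemma HsPlus.toLinf_smul (hs : 1 / 2 < s) (c : ℂ) (U : HsPlus s M N) :
    (c • U).toLinf hs = c • U.toLinf hs := by
  refine Lp.ext ?_
  filter_upwards [coeFn_toLinf hs (c • U), coeFn_toLinf hs U,
    Lp.coeFn_smul c (U.toLinf hs), Lp.coeFn_smul c U.toL2] with x h1 h2 h3 h4
  rw [h1, h3, Pi.smul_apply, h2, map_smul, h4, Pi.smul_apply]

/-- The Sobolev embedding of `H^s_+` into `L^∞`, as a continuous linear map. -/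
def HsPlus.toLinfL (hs : 1 / 2 < s) : HsPlus s M N →L[ℂ] Linf M N :=
  LinearMap.mkContinuous
    { toFun := HsPlus.toLinf hs
      map_add' := HsPlus.toLinf_add hs
      map_smul' := HsPlus.toLinf_smul hs } (sobolevConst s) (HsPlus.norm_toLinf_le hs)

/-- The right Hankel operator, as a continuous linear function of its symbol. -/
def hankelRL (d : ℕ) : Linf M N →L[ℂ] L2Plus d N →L⋆[ℂ] L2Plus M d :=
  (ContinuousLinearMap.compSL (L2Plus d N) (L2 M d) (L2Plus M d) (starRingEnd ℂ) (RingHom.id ℂ)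
      (szegoPlus M d)) ∘L
    ((ContinuousLinearMap.compSL (L2Plus d N) (L2 N d) (L2 M d) (starRingEnd ℂ) (RingHom.id ℂ)).flip
      ((adjLp 2 d N).comp L2Plus.toL2)) ∘L mulLp

/-- The left Hankel operator, as a continuous linear function of its symbol. -/
def hankelLL (d : ℕ) : Linf M N →L[ℂ] L2Plus M d →L⋆[ℂ] L2Plus d N :=
  (ContinuousLinearMap.compSL (L2Plus M d) (L2 d N) (L2Plus d N) (starRingEnd ℂ) (RingHom.id ℂ)
      (szegoPlus d N)) ∘L
    ((ContinuousLinearMap.compSL (L2Plus M d) (L2 d M) (L2 d N) (starRingEnd ℂ) (RingHom.id ℂ)).flip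
      ((adjLp 2 M d).comp L2Plus.toL2)) ∘L mulLp.flip

/-- The composition of two antilinear operators which depend linearly on parameters is bilinear
over `ℝ`, but only antilinear over `ℂ` in the second parameter. -/
lemma isBoundedBilinearMap_comp_conj {X E F G : Type*} [NormedAddCommGroup X] [NormedSpace ℂ X]
    [NormedAddCommGroup E] [NormedSpace ℂ E] [NormedAddCommGroup F] [NormedSpace ℂ F]
    [NormedAddCommGroup G] [NormedSpace ℂ G] (A : X →L[ℂ] F →L⋆[ℂ] G) (B : X →L[ℂ] E →L⋆[ℂ] F) :
    IsBoundedBilinearMap ℝ fun p : X × X => ((A p.1).comp (B p.2) : E →L[ℂ] G) where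
  add_left x₁ x₂ y := by ext; simp
  smul_left c x y := by
    ext
    simp [← Complex.coe_smul]
  add_right x y₁ y₂ := by ext; simp
  smul_right c x y := by
    ext
    simp [← Complex.coe_smul]
  bound := by
    refine ⟨‖A‖ * ‖B‖ + 1, by positivity, fun x y => ?_⟩
    have h1 := ContinuousLinearMap.opNorm_comp_le (A x) (B y)
    have h2 := A.le_opNorm x
    have h3 := B.le_opNorm y
    calc _ ≤ (‖A‖ * ‖x‖) * (‖B‖ * ‖y‖) := h1.trans (by gcongr)
      _ ≤ _ := by nlinarith [mul_nonneg (norm_nonneg x) (norm_nonneg y)]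

end Continuity

/-! ### The Heisenberg-Lax equations -/

variable {M N d : ℕ} {s : ℝ}

lemma isBoundedBilinearMap_hankelR_hankelL (d : ℕ) (hs : 1 / 2 < s) :
    IsBoundedBilinearMap ℝ fun p : HsPlus s M N × HsPlus s M N =>
      ((hankelR d (p.1.toLinf hs)).comp (hankelL d (p.2.toLinf hs)) :
        L2Plus M d →L[ℂ] L2Plus M d) :=
  isBoundedBilinearMap_comp_conj (hankelRL d ∘L HsPlus.toLinfL hs)
    (hankelLL d ∘L HsPlus.toLinfL hs)

lemma isBoundedBilinearMap_hankelL_hankelR (d : ℕ) (hs : 1 / 2 < s) :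
    IsBoundedBilinearMap ℝ fun p : HsPlus s M N × HsPlus s M N =>
      ((hankelL d (p.1.toLinf hs)).comp (hankelR d (p.2.toLinf hs)) :
        L2Plus d N →L[ℂ] L2Plus d N) :=
  isBoundedBilinearMap_comp_conj (hankelLL d ∘L HsPlus.toLinfL hs)
    (hankelRL d ∘L HsPlus.toLinfL hs)

lemma _root_.IsBoundedBilinearMap.contDiff_diag {X Y : Type*} [NormedAddCommGroup X]
    [NormedSpace ℝ X] [NormedAddCommGroup Y] [NormedSpace ℝ Y] {B : X × X → Y}
    (hB : IsBoundedBilinearMap ℝ B) {U : ℝ → X} (hU : ContDiff ℝ ∞ U) :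
    ContDiff ℝ ∞ fun t => B (U t, U t) :=
  ContDiff.comp (f := fun t => (U t, U t)) hB.contDiff (hU.prodMk hU)

lemma _root_.IsBoundedBilinearMap.hasDerivAt_diag {X Y : Type*} [NormedAddCommGroup X]
    [NormedSpace ℝ X] [NormedAddCommGroup Y] [NormedSpace ℝ Y] {B : X × X → Y}
    (hB : IsBoundedBilinearMap ℝ B) {U : ℝ → X} {U' : X} {t : ℝ} (hU : HasDerivAt U U' t) :
    HasDerivAt (fun t => B (U t, U t)) (B (U t, U') + B (U', U t)) t :=
  HasFDerivAt.comp_hasDerivAt (f := fun t => (U t, U t)) t (hB.hasFDerivAt (U t, U t))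
    (hU.prodMk hU)

lemma hankelR_smul (c : ℂ) (u : Linf M N) : hankelR d (c • u) = c • hankelR d u :=
  (hankelRL d).map_smul c u

lemma hankelL_smul (c : ℂ) (u : Linf M N) : hankelL d (c • u) = c • hankelL d u :=
  (hankelLL d).map_smul c u

section Derivative

variable {U V : HsPlus s M N}

/-- If `i V = Π (U U^* U)`, then `i V` and `U U^* U` differ by a function with spectrum
in `(-∞, 0]`. -/
lemma exists_cubic_sub (hs : 1 / 2 < s) (hV : I • V.toL2 = szego M N (U.cubic hs)) :
    ∃ z : L2 M N, SpecVanish (Set.Ioi 0) z ∧ z =ᵐ[volume] fun x =>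
      (mulLp (U.mulAdj hs) (U.toLinf hs) : Linf M N) x - (I • V.toLinf hs) x := by
  refine ⟨U.cubic hs - szego M N (U.cubic hs), specVanish_sub_szego _, ?_⟩
  rw [← hV]
  filter_upwards [Lp.coeFn_sub (U.cubic hs) (I • V.toL2), Lp.coeFn_smul I V.toL2,
    Lp.coeFn_smul I (V.toLinf hs), V.coeFn_toLinf hs, U.coeFn_toLinf hs,
    coeFn_mulLp (r := ∞) (U.mulAdj hs) (U.toLinf hs),
    coeFn_mulLp (r := 2) (U.mulAdj hs) U.toL2] with x h1 h2 h3 h4 h5 h6 h7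
  have h8 : U.cubic hs x = CMat.mulL M M N (U.mulAdj hs x) (U.toL2 x) := h7
  rw [h1, Pi.sub_apply, h2, Pi.smul_apply, h3, Pi.smul_apply, h4, h6, h5, h8]

lemma HsPlus.specVanish (U : HsPlus s M N) : SpecVanish (Set.Iio 0) U.toL2 :=
  specVanish_of_mem_szegoRange U.2

lemma hankelR_of_solution (hs : 1 / 2 < s) (hV : I • V.toL2 = szego M N (U.cubic hs))
    (F : L2Plus d N) :
    hankelR d (V.toLinf hs) F = -I • (toeplitzR d (U.mulAdj hs) (hankelR d (U.toLinf hs) F)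
      + hankelR d (U.toLinf hs) (toeplitzL d (U.adjMul hs) F)
      - hankelR d (U.toLinf hs) (hankelL d (U.toLinf hs) (hankelR d (U.toLinf hs) F))) := by
  obtain ⟨z, hz', hz⟩ := exists_cubic_sub hs hV
  have h := hankelR_cubic (U.coeFn_toLinf hs).symm U.specVanish hz hz' F
  unfold HsPlus.mulAdj HsPlus.adjMul
  rw [← h, hankelR_smul, smul_apply, smul_smul]
  simp

lemma hankelL_of_solution (hs : 1 / 2 < s) (hV : I • V.toL2 = szego M N (U.cubic hs))
    (G : L2Plus M d) :
    hankelL d (V.toLinf hs) G = -I • (toeplitzL d (U.adjMul hs) (hankelL d (U.toLinf hs) G)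
      + hankelL d (U.toLinf hs) (toeplitzR d (U.mulAdj hs) G)
      - hankelL d (U.toLinf hs) (hankelR d (U.toLinf hs) (hankelL d (U.toLinf hs) G))) := by
  obtain ⟨z, hz', hz⟩ := exists_cubic_sub hs hV
  have h := hankelL_cubic (U.coeFn_toLinf hs).symm U.specVanish hz hz' G
  unfold HsPlus.mulAdj HsPlus.adjMul
  rw [← h, hankelL_smul, smul_apply, smul_smul]
  simp

/-- The sign of `-i` is reversed by the antilinear operator `H^{(r)}_U`, so that the sum of the
two terms of the product rule is a commutator. -/
lemma hankelR_hankelL_commutator (hs : 1 / 2 < s)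
    (hV : I • V.toL2 = szego M N (U.cubic hs)) :
    ((hankelR d (U.toLinf hs)).comp (hankelL d (V.toLinf hs)) : L2Plus M d →L[ℂ] L2Plus M d) +
      (hankelR d (V.toLinf hs)).comp (hankelL d (U.toLinf hs)) =
    I • (doubleHankelRL d hs U ∘L toeplitzR d (U.mulAdj hs)
      - toeplitzR d (U.mulAdj hs) ∘L doubleHankelRL d hs U) := by
  ext1 G
  simp only [doubleHankelRL, add_apply, smul_apply, sub_apply, ContinuousLinearMap.comp_apply,
    hankelR_of_solution hs hV, hankelL_of_solution hs hV, map_smulₛₗ, map_add, map_sub, map_neg,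
    conj_I]
  module

lemma hankelL_hankelR_commutator (hs : 1 / 2 < s)
    (hV : I • V.toL2 = szego M N (U.cubic hs)) :
    ((hankelL d (U.toLinf hs)).comp (hankelR d (V.toLinf hs)) : L2Plus d N →L[ℂ] L2Plus d N) +
      (hankelL d (V.toLinf hs)).comp (hankelR d (U.toLinf hs)) =
    I • (doubleHankelLR d hs U ∘L toeplitzL d (U.adjMul hs)
      - toeplitzL d (U.adjMul hs) ∘L doubleHankelLR d hs U) := by
  ext1 F
  simp only [doubleHankelLR, add_apply, smul_apply, sub_apply, ContinuousLinearMap.comp_apply,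
    hankelR_of_solution hs hV, hankelL_of_solution hs hV, map_smulₛₗ, map_add, map_sub, map_neg,
    conj_I]
  module

end Derivative

end MatrixSzego

end

open MatrixSzego in
theorem proposition2 {s : ℝ} (hs : 1 / 2 < s) {M N : ℕ} (hM : 0 < M) (hN : 0 < N)
    (U : ℝ → HsPlus s M N) (hU : ContDiff ℝ ∞ U) (hSz : SolvesSzego hs U)
    (d : ℕ) (hd : 0 < d) :
    -- the double Hankel operators are smooth in time, for the operator norm
    ContDiff ℝ ∞ (fun t => doubleHankelRL d hs (U t)) ∧
    ContDiff ℝ ∞ (fun t => doubleHankelLR d hs (U t)) ∧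
    -- and they satisfy the Heisenberg-Lax equations
    (∀ t : ℝ, HasDerivAt (fun t => doubleHankelRL d hs (U t))
      (Complex.I • (doubleHankelRL d hs (U t) ∘L toeplitzR d ((U t).mulAdj hs)
        - toeplitzR d ((U t).mulAdj hs) ∘L doubleHankelRL d hs (U t))) t) ∧
    (∀ t : ℝ, HasDerivAt (fun t => doubleHankelLR d hs (U t))
      (Complex.I • (doubleHankelLR d hs (U t) ∘L toeplitzL d ((U t).adjMul hs)
        - toeplitzL d ((U t).adjMul hs) ∘L doubleHankelLR d hs (U t))) t) := by
  have hRL := isBoundedBilinearMap_hankelR_hankelL (M := M) (N := N) d hs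
  have hLR := isBoundedBilinearMap_hankelL_hankelR (M := M) (N := N) d hs
  refine ⟨hRL.contDiff_diag hU, hLR.contDiff_diag hU, fun t => ?_, fun t => ?_⟩
  · rw [← hankelR_hankelL_commutator hs (hSz t).2]
    exact hRL.hasDerivAt_diag (hSz t).1.hasDerivAt
  · rw [← hankelL_hankelR_commutator hs (hSz t).2]
    exact hLR.hasDerivAt_diag (hSz t).1.hasDerivAt
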